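/- Let $Y$ be a separable real Banach space with dual $X=Y^\star$, let $\iota:Y\to X^\star$ be the canonical embedding, and let $Z$ be a real Banach space. Let $G:X\to Z$ be twice continuously Fréchet differentiable, $K\subseteq Z$ closed, convex and non-empty, $C:=G^{-1}(K)$, $\bar x\in C$. Here $t_k\searrow0$ means $t_k>0$, $t_k\to0$, and weak-$\star$ (semi)continuity is understood sequentially. Notation. For a subset $S$ of a normed space $E$ and $x\in S$ put - $\mathcal R_S(x)=\{h : \exists T>0\ \forall t\in[0,T]:\ x+th\in S\}$, - $\mathcal T_S(x)=\{h:\exists t_k\searrow0,\ x_k\in S,\ (x_k-x)/t_k\to h\}$, - $\mathcal T^2_S(x,h)=\{r:\exists t_n\searrow0,\ \operatorname{dist}(x+t_nh+\tfrac12t_n^2r,S)=o(t_n^2)\}$. $S$ is second-order regular at $x$ if $\operatorname{dist}(r_n,\mathcal T_S^2(x,h))\to0$ for all $h\in\mathcal T_S(x)$ and all sequences $t_n\searrow0$, $r_n$ with $t_nr_n\to0$ and $x+t_nh+\frac12t_n^2r_n\in S$ (with $\operatorname{dist}(\cdot,\emptyset)=\infty$). If $E$ is the dual of a separable Banach space $V$,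 let $\mathcal T_S^\star(x)$ be defined as $\mathcal T_S(x)$ with weak-$\star$ instead of norm convergence, let $\mathcal N_S^\star(x)$ be the set of all $\psi\in E^\star$ in the canonical image of $V$ with $\langle\psi,h\rangle\le0$ for all $h\in\mathcal T^\star_S(x)$, and, for $\varphi\in-\mathcal N_S^\star(x)$ and $h\in \mathcal T^\star_S(x)\cap\varphi^\perp$, let $Q_S^{x,\varphi}(h)\in[-\infty,\infty]$ be the infimum of $\liminf_k\langle\varphi,r_k\rangle$ over all sequences $t_k\searrow0$, $r_k\in E$ with $t_kr_k\rightharpoonup^\star0$ and $x+t_kh+\frac12t_k^2r_k\in S$. The condition (MRC) holds for $S$ in $(x,\varphi)$ if for every $h\in\mathcal T_S^\star(x)\cap\varphi^\perp$ there are $t_k\searrow0$, $r_k\in E$ with $t_kr_k\to0$ in norm, $x+t_kh+\frac12t_k^2r_k\in S$ and $\langle\varphi,r_k\rangle\to Q_S^{x,\varphi}(h)$. Assumptions. Let $J:C\to\mathbb R$, $J'(\bar x)\in\iota(Y)$ and a bounded bilinear form $J''(\bar x):X\times X\to\mathbb R$ be such that $$\lim_{k\to\infty}\frac{J(\bar x+t_kh_k)-J(\bar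 x)-t_kJ'(\bar x)h_k-\frac12t_k^2J''(\bar x)h_k^2}{t_k^2}=0$$ whenever $t_k\searrow0$, $h_k\rightharpoonup^\star h$ for some $h \in X$, and $\bar x+t_kh_k\in C$. Assume that 1. $J'(\bar x)\in-\mathcal N_C^\star(\bar x)$, and $h\mapsto J''(\bar x)h^2$ is weak-$\star$ lower semicontinuous; 2. (NDC) $\liminf_k\big(\langle J'(\bar x),h_k/t_k\rangle+\frac12J''(\bar x)h_k^2\big)>0$ whenever $t_k\searrow0$, $h_k\rightharpoonup^\star0$, $\|h_k\|_X=1$, $\bar x+t_kh_k\in C$; 3. $h\mapsto G'(\bar x)h$ and $h\mapsto G''(\bar x)h^2$ are weak-$\star$-to-strong continuous; 4. $K$ is second-order regular at $G(\bar x)$, and $G'(\bar x)X-\mathcal R_K(G(\bar x))=Z$. Conclusion. The condition $$J''(\bar x)h^2+\inf_{r\in G'(\bar x)^{-1}(\mathcal T_K^2(G(\bar x),G'(\bar x)h)-G''(\bar x)h^2)}\langle J'(\bar x),r\rangle>0\quad\text{for all }h\in \big(J'(\bar x)^\perp\cap G'(\bar x)^{-1}\mathcal T_K(G(\bar x))\big)\setminus\{0\}\qquad(\ast)$$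 is equivalent to quadratic growth: there are $c>0$, $\varepsilon>0$ with $J(x)\ge J(\bar x)+\frac c2\|x-\bar x\|_X^2$ for all $x\in C$ with $\|x-\bar x\|_X\le\varepsilon$. If, moreover, $Z$ is the dual of a separable Banach space and there is a $\lambda\in\mathcal N_K^\star(G(\bar x))$ with $J'(\bar x)+G'(\bar x)^\star\lambda=0$ such that (MRC) holds for $K$ in $(G(\bar x),-\lambda)$ and $Z=G'(\bar x)X-\mathcal R_K(G(\bar x))\cap\lambda^\perp$, then $(\ast)$ is equivalent to $$\partial_{xx}L(\bar x,\lambda)h^2+Q_K^{G(\bar x),-\lambda}(G'(\bar x)h)>0\quad\text{for all }h\in \big(J'(\bar x)^\perp\cap G'(\bar x)^{-1}\mathcal T_K(G(\bar x))\big)\setminus\{0\},$$ where $L(x,\lambda)=J(x)+\langle\lambda,G(x)\rangle$, i.e. $\partial_{xx}L(\bar x,\lambda)h^2=J''(\bar x)h^2+\langle\lambda,G''(\bar x)h^2\rangle$. -/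

import Mathlib

open Filter Topology Set
open scoped Pointwise

namespace NoGap

/-- `t_k ↘ 0`: a sequence of positive reals that converges to zero. -/
def DecreasesToZero (t : ℕ → ℝ) : Prop :=
  (∀ k, 0 < t k) ∧ Tendsto t atTop (𝓝 0)

section Strong

variable {E : Type*} [NormedAddCommGroup E] [NormedSpace ℝ E]

/-- The radial cone `R_C(x)`. -/
def radialCone (C : Set E) (x : E) : Set E :=
  {h | ∃ T : ℝ, 0 < T ∧ ∀ t ∈ Icc (0 : ℝ) T, x + t • h ∈ C}

/-- The strong outer tangent cone `T_C(x)`. -/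
def tangentCone (C : Set E) (x : E) : Set E :=
  {h | ∃ (t : ℕ → ℝ) (xs : ℕ → E), DecreasesToZero t ∧ (∀ k, xs k ∈ C) ∧
    Tendsto (fun k => (t k)⁻¹ • (xs k - x)) atTop (𝓝 h)}

/-- The strong outer second-order tangent set `T_C²(x, h)`: the `r` such that
`dist (x + t_n h + (1/2) t_n² r, C) = o(t_n²)` for some `t_n ↘ 0`. It is only used for
`x ∈ C`, so that `C` is non-empty and `Metric.infDist` is the distance. -/
def secondTangentSet (C : Set E) (x h : E) : Set E :=
  {r | ∃ t : ℕ → ℝ, DecreasesToZero t ∧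
    Tendsto (fun n =>
      Metric.infDist (x + t n • h + ((1 / 2 : ℝ) * t n ^ 2) • r) C / t n ^ 2) atTop (𝓝 0)}

/-- (Outer) second-order regularity of `C` at `x`. The distance to the empty set is `∞`,
therefore the extended distance is used. -/
def SecondOrderRegular (C : Set E) (x : E) : Prop :=
  ∀ h ∈ tangentCone C x, ∀ (t : ℕ → ℝ) (r : ℕ → E), DecreasesToZero t →
    Tendsto (fun n => t n • r n) atTop (𝓝 0) →
    (∀ n, x + t n • h + ((1 / 2 : ℝ) * t n ^ 2) • r n ∈ C) →
    Tendsto (fun n => Metric.infEDist (r n) (secondTangentSet C x h)) atTop (𝓝 0)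

/-- Quadratic growth: `J x ≥ J x₀ + (c/2) ‖x - x₀‖²` for all `x ∈ C` in a closed ball of radius
`ε` around `x₀`, with some constants `c > 0` and `ε > 0`. -/
def QuadraticGrowth (C : Set E) (J : E → ℝ) (x₀ : E) : Prop :=
  ∃ c : ℝ, 0 < c ∧ ∃ ε : ℝ, 0 < ε ∧
    ∀ x ∈ C ∩ Metric.closedBall x₀ ε, J x₀ + c / 2 * ‖x - x₀‖ ^ 2 ≤ J x

end Strong

section WeakStar

/-! In this section `X` is the dual of the normed space `Y`; the identification of `X` with the
dual is `d : X ≃ₗᵢ[ℝ] StrongDual ℝ Y`. -/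

variable {X Y : Type*} [NormedAddCommGroup X] [NormedSpace ℝ X]
  [NormedAddCommGroup Y] [NormedSpace ℝ Y]

/-- The canonical embedding `ι : Y → X*`, `⟨ι y, h⟩ = ⟨h, y⟩`. -/
noncomputable def canonicalEmbedding (d : X ≃ₗᵢ[ℝ] StrongDual ℝ Y) : Y →L[ℝ] StrongDual ℝ X :=
  (d.toContinuousLinearEquiv : X →L[ℝ] StrongDual ℝ Y).flip

/-- Weak-⋆ convergence of a sequence in `X`. -/
def WeakStarTendsto (d : X ≃ₗᵢ[ℝ] StrongDual ℝ Y) (u : ℕ → X) (x : X) : Prop :=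
  ∀ y : Y, Tendsto (fun k => d (u k) y) atTop (𝓝 (d x y))

/-- The weak-⋆ outer tangent cone. -/
def weakStarTangentCone (d : X ≃ₗᵢ[ℝ] StrongDual ℝ Y) (C : Set X) (x : X) : Set X :=
  {h | ∃ (t : ℕ → ℝ) (xs : ℕ → X), DecreasesToZero t ∧ (∀ k, xs k ∈ C) ∧
    WeakStarTendsto d (fun k => (t k)⁻¹ • (xs k - x)) h}

/-- The weak-⋆ normal cone, a subset of `ι(Y)`. -/
def weakStarNormalCone (d : X ≃ₗᵢ[ℝ] StrongDual ℝ Y) (C : Set X) (x : X) :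
    Set (StrongDual ℝ X) :=
  {φ | φ ∈ range (canonicalEmbedding d) ∧ ∀ h ∈ weakStarTangentCone d C x, φ h ≤ 0}

/-- The weak-⋆ critical cone `T_C^⋆(x) ∩ φ^⊥`. -/
def weakStarCriticalCone (d : X ≃ₗᵢ[ℝ] StrongDual ℝ Y) (C : Set X) (x : X)
    (φ : StrongDual ℝ X) : Set X :=
  {h | h ∈ weakStarTangentCone d C x ∧ φ h = 0}

/-- The weak-⋆ directional curvature functional `Q_C^{x,φ}(h)` with values in `[-∞, ∞]`. -/
noncomputable def curvature (d : X ≃ₗᵢ[ℝ] StrongDual ℝ Y) (C : Set X) (x : X)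
    (φ : StrongDual ℝ X) (h : X) : EReal :=
  sInf {q : EReal | ∃ (r : ℕ → X) (t : ℕ → ℝ), DecreasesToZero t ∧
    WeakStarTendsto d (fun k => t k • r k) 0 ∧
    (∀ k, x + t k • h + ((1 / 2 : ℝ) * t k ^ 2) • r k ∈ C) ∧
    q = liminf (fun k => ((φ (r k) : ℝ) : EReal)) atTop}

/-- The Mosco regularity condition (MRC) of `C` in `(x, φ)`. -/
def MoscoRegular (d : X ≃ₗᵢ[ℝ] StrongDual ℝ Y) (C : Set X) (x : X)
    (φ : StrongDual ℝ X) : Prop :=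
  ∀ h ∈ weakStarCriticalCone d C x φ, ∃ (r : ℕ → X) (t : ℕ → ℝ), DecreasesToZero t ∧
    Tendsto (fun k => t k • r k) atTop (𝓝 0) ∧
    (∀ k, x + t k • h + ((1 / 2 : ℝ) * t k ^ 2) • r k ∈ C) ∧
    Tendsto (fun k => ((φ (r k) : ℝ) : EReal)) atTop (𝓝 (curvature d C x φ h))

/-- Second-order Taylor expansion at `x₀` relative to `C`, along weak-⋆ convergent directions,
with first derivative `J₁ ∈ ι(Y)` and bounded bilinear second derivative `J₂`.
Only the values of `J` on `C` enter. -/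
def HasWeakStarTaylor (d : X ≃ₗᵢ[ℝ] StrongDual ℝ Y) (C : Set X) (J : X → ℝ) (x₀ : X)
    (J₁ : StrongDual ℝ X) (J₂ : X →L[ℝ] X →L[ℝ] ℝ) : Prop :=
  J₁ ∈ range (canonicalEmbedding d) ∧
  ∀ (u : ℕ → X) (t : ℕ → ℝ) (h : X), DecreasesToZero t → WeakStarTendsto d u h →
    (∀ k, x₀ + t k • u k ∈ C) →
    Tendsto (fun k =>
      (J (x₀ + t k • u k) - J x₀ - t k * J₁ (u k) - 1 / 2 * t k ^ 2 * J₂ (u k) (u k)) / t k ^ 2)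
      atTop (𝓝 0)

/-- The non-degeneracy condition (NDC); the limes inferior is taken in `[-∞, ∞]`. -/
def NonDegenerate (d : X ≃ₗᵢ[ℝ] StrongDual ℝ Y) (C : Set X) (x₀ : X)
    (J₁ : StrongDual ℝ X) (J₂ : X →L[ℝ] X →L[ℝ] ℝ) : Prop :=
  ∀ (u : ℕ → X) (t : ℕ → ℝ), DecreasesToZero t → WeakStarTendsto d u 0 →
    (∀ k, x₀ + t k • u k ∈ C) → (∀ k, ‖u k‖ = 1) →
    (0 : EReal) <
      liminf (fun k => ((J₁ (u k) / t k + 1 / 2 * J₂ (u k) (u k) : ℝ) : EReal)) atTop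

/-- (Sequential) weak-⋆ lower semicontinuity of a real function. -/
def WeakStarLSC (d : X ≃ₗᵢ[ℝ] StrongDual ℝ Y) (f : X → ℝ) : Prop :=
  ∀ (u : ℕ → X) (x : X), WeakStarTendsto d u x →
    ((f x : ℝ) : EReal) ≤ liminf (fun k => ((f (u k) : ℝ) : EReal)) atTop

/-- (Sequential) weak-⋆-to-strong continuity. -/
def WeakStarToStrongContinuous (d : X ≃ₗᵢ[ℝ] StrongDual ℝ Y) {Z : Type*} [NormedAddCommGroup Z]
    (F : X → Z) : Prop :=
  ∀ (u : ℕ → X) (x : X), WeakStarTendsto d u x → Tendsto (fun k => F (u k)) atTop (𝓝 (F x))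

end WeakStar

section Preimage

variable {X Z : Type*} [NormedAddCommGroup X] [NormedSpace ℝ X]
  [NormedAddCommGroup Z] [NormedSpace ℝ Z]

/-- The quadratic form `G''(x) h²` of the second Fréchet derivative. -/
noncomputable def secondDerivSq (G : X → Z) (x h : X) : Z :=
  fderiv ℝ (fderiv ℝ G) x h h

/-- The non-zero elements of `J₁^⊥ ∩ G'(x₀)⁻¹ T_K(G x₀)`. -/
def nonzeroCriticalDirections (G : X → Z) (K : Set Z) (x₀ : X) (J₁ : StrongDual ℝ X) : Set X :=
  ({h | J₁ h = 0} ∩ fderiv ℝ G x₀ ⁻¹' tangentCone K (G x₀)) \ {0}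

/-- `J₂ h² + inf {⟨J₁, r⟩ | r ∈ G'(x₀)⁻¹ (T_K²(G x₀, G'(x₀) h) - G''(x₀) h²)} > 0` for all
non-zero critical `h`; the infimum is taken in `[-∞, ∞]`. -/
def PullBackSSC (G : X → Z) (K : Set Z) (x₀ : X) (J₁ : StrongDual ℝ X)
    (J₂ : X →L[ℝ] X →L[ℝ] ℝ) : Prop :=
  ∀ h ∈ nonzeroCriticalDirections G K x₀ J₁,
    (0 : EReal) < ((J₂ h h : ℝ) : EReal) +
      ⨅ r ∈ fderiv ℝ G x₀ ⁻¹'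
        (secondTangentSet K (G x₀) (fderiv ℝ G x₀ h) - {secondDerivSq G x₀ h}),
        ((J₁ r : ℝ) : EReal)

/-- `∂_xx L(x₀, lam) h²` for the Lagrangian `L(x, lam) = J(x) + ⟨lam, G(x)⟩`, where `J₂` is the
second derivative of `J` at `x₀`. -/
noncomputable def lagrangianHessianSq (G : X → Z) (x₀ : X) (J₂ : X →L[ℝ] X →L[ℝ] ℝ)
    (lam : StrongDual ℝ Z) (h : X) : ℝ :=
  J₂ h h + lam (secondDerivSq G x₀ h)

end Preimage

end NoGap

/-! Growth implies `(∗)`: a critical `h` and an admissible `r` are realised by an arc `x₀ + t h + ½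
t² ρ` in `C` with `ρ → r`. As `J₁ h = 0`, dividing the growth inequality by `t²` and passing to the
limit gives `J₂ h² + J₁ r ≥ c ‖h‖²`, uniformly in `r`. The arc comes from metric regularity of `G x
∈ K` (`exists_metric_regularity`, `exists_feasible_arc`).

Conversely, if growth fails, points of `C` violating it have normalised directions `u_k` with a
weak-⋆ limit `h`. (NDC) excludes `h = 0`, and `h` is critical. Expanding `G` writes the images as `G
x₀ + t A h + ½ t² r_k` with `A = G'(x₀)` and `t r_k → 0`. Second-order regularity moves `r_k` into
the second-order tangent set at vanishing cost, and `exists_bounded_decomposition` converts the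
error into a vanishing `v_k` in `X`. Testing `(∗)` with `2 t⁻¹ (u_k - h) + v_k` bounds the limes
superior of `J₂ u_k²` strictly below `J₂ h²`, against lower semicontinuity.

With a multiplier, `J₁ = -lam ∘ A` turns the infimum into one of `-lam` over second-order tangents
of `K`, up to the term from `G''`. (MRC) and second-order regularity identify it with the curvature;
the strict qualification lifts tangents to `X` without changing `lam`. -/

namespace NoGap

/-! ### Constraint qualification and metric regularity -/

section Regularity

variable {X Z : Type*} [NormedAddCommGroup X] [NormedSpace ℝ X]
  [NormedAddCommGroup Z] [NormedSpace ℝ Z]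

/-- The truncated images `A B - (K - z) ∩ B`, with `B` the closed unit balls, of a regular pair
are dense in a ball around the origin. -/
def NearlyOpen (A : X →L[ℝ] Z) (K : Set Z) (z : Z) (δ : ℝ) : Prop :=
  ∀ y : Z, ‖y‖ ≤ δ → ∀ ε : ℝ, 0 < ε → ∃ (v : X) (k : Z), ‖v‖ ≤ 1 ∧ k ∈ K ∧ ‖k - z‖ ≤ 1 ∧
    ‖y - (A v - (k - z))‖ ≤ ε

/-- Baire's theorem: the dilates of the closure of the convex set `S` cover `Z`, so this closure has
an interior point. Convexity carries the interior point to the origin. -/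
theorem exists_nearlyOpen [CompleteSpace Z] (A : X →L[ℝ] Z) {K : Set Z} (hK : Convex ℝ K)
    {z : Z} (hCQ : range A - radialCone K z = univ) :
    ∃ δ : ℝ, 0 < δ ∧ NearlyOpen A K z δ := by
  set S : Set Z := (A '' Metric.closedBall 0 1) -
    ((fun k => k - z) '' K ∩ Metric.closedBall 0 1) with hS
  have hSconv : Convex ℝ S := by
    refine Convex.sub ((convex_closedBall (0 : X) 1).linear_image A.toLinearMap) ?_
    refine Convex.inter ?_ (convex_closedBall _ _)
    simpa [sub_eq_add_neg] using hK.translate_preimage_left z |>.neg.neg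
  have hscale : ∀ y : Z, ∃ n : ℕ, ((n : ℝ) + 1)⁻¹ • y ∈ S := by
    intro y
    have hy : y ∈ range A - radialCone K z := hCQ ▸ mem_univ y
    obtain ⟨_, ⟨x, rfl⟩, w, ⟨T, hT, hw⟩, rfl⟩ := hy
    obtain ⟨n, hn⟩ := exists_nat_ge (max (max ‖x‖ ‖w‖) T⁻¹)
    have hn0 : (0 : ℝ) < (n : ℝ) + 1 := by positivity
    have h1 : ‖x‖ ≤ (n : ℝ) + 1 := by
      linarith [le_max_left (max ‖x‖ ‖w‖) T⁻¹, le_max_left ‖x‖ ‖w‖]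
    have h2 : ‖w‖ ≤ (n : ℝ) + 1 := by
      linarith [le_max_left (max ‖x‖ ‖w‖) T⁻¹, le_max_right ‖x‖ ‖w‖]
    have h3 : T⁻¹ ≤ (n : ℝ) + 1 := by
      linarith [le_max_right (max ‖x‖ ‖w‖) T⁻¹]
    have hle : ∀ a : ℝ, a ≤ (n : ℝ) + 1 → ((n : ℝ) + 1)⁻¹ * a ≤ 1 := fun a ha => by
      rw [inv_mul_le_iff₀ hn0]; linarith
    refine ⟨n, ?_⟩
    rw [smul_sub, ← map_smul]
    refine sub_mem_sub ⟨_, ?_, rfl⟩ ⟨⟨z + ((n : ℝ) + 1)⁻¹ • w, hw _ ⟨by positivity, ?_⟩, by simp⟩, ?_⟩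
    · rw [mem_closedBall_zero_iff, norm_smul, Real.norm_of_nonneg (by positivity)]
      exact hle _ h1
    · exact inv_le_of_inv_le₀ hT h3
    · rw [mem_closedBall_zero_iff, norm_smul, Real.norm_of_nonneg (by positivity)]
      exact hle _ h2
  have h0 : (0 : Z) ∈ interior (closure S) := by
    obtain ⟨n, hn⟩ := nonempty_interior_of_iUnion_of_closed
      (f := fun n : ℕ => (fun y : Z => ((n : ℝ) + 1)⁻¹ • y) ⁻¹' closure S)
      (fun n => isClosed_closure.preimage (continuous_const_smul _))
      (eq_univ_of_forall fun y => mem_iUnion.2 <|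
        (hscale y).imp fun n hn => subset_closure hn)
    obtain ⟨y, hy⟩ := hn
    have hne : ((n : ℝ) + 1)⁻¹ ≠ 0 := by positivity
    have hy' : ((n : ℝ) + 1)⁻¹ • y ∈ interior (closure S) := by
      have := (Homeomorph.smulOfNeZero (α := Z) _ hne).preimage_interior (closure S)
      have hy2 : y ∈ (Homeomorph.smulOfNeZero (α := Z) _ hne) ⁻¹' interior (closure S) := by
        rw [this]; exact hy
      exact hy2
    set y' := ((n : ℝ) + 1)⁻¹ • y
    -- A multiple of `-y'` lies in `S`; the weights below place `0` on the segment joining it to the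
    -- interior point `y'`.
    obtain ⟨m, hm⟩ := hscale (-y')
    have hm0 : (0 : ℝ) < (m : ℝ) + 1 := by positivity
    have := hSconv.closure.combo_interior_self_mem_interior hy' (subset_closure hm)
      (a := ((m : ℝ) + 2)⁻¹) (b := ((m : ℝ) + 1) / ((m : ℝ) + 2)) (by positivity) (by positivity)
      (by field_simp; ring)
    convert this using 1
    rw [smul_neg, smul_neg, ← sub_eq_add_neg, smul_smul _ _ y', ← sub_smul]
    have : ((m : ℝ) + 2)⁻¹ - ((m : ℝ) + 1) / ((m : ℝ) + 2) * ((m : ℝ) + 1)⁻¹ = 0 := by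
      field_simp; ring
    rw [this, zero_smul]
  rw [mem_interior_iff_mem_nhds, Metric.nhds_basis_closedBall.mem_iff] at h0
  obtain ⟨δ, hδ, hball⟩ := h0
  refine ⟨δ, hδ, fun y hy ε hε => ?_⟩
  obtain ⟨s, hs, hys⟩ := Metric.mem_closure_iff.1 (hball (mem_closedBall_zero_iff.2 hy)) ε hε
  obtain ⟨_, ⟨v, hv, rfl⟩, _, ⟨⟨k, hk, rfl⟩, hk1⟩, rfl⟩ := hs
  exact ⟨v, k, by simpa using hv, hk, by simpa using hk1, by rw [dist_eq_norm] at hys; exact hys.le⟩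

/-- One step of the Newton-type iteration in `NearlyOpen.exists_mem_preimage`. -/
theorem NearlyOpen.newton_step {A : X →L[ℝ] Z} {K : Set Z} (hK : Convex ℝ K) {z : Z} {δ : ℝ}
    (hδ : 0 < δ) (hδ1 : δ ≤ 1) (hA : NearlyOpen A K z δ) {F : X → Z} {x₀ : X} {R : ℝ}
    (hF : ∀ x ∈ Metric.closedBall x₀ R, ∀ x' ∈ Metric.closedBall x₀ R,
      ‖F x' - F x - A (x' - x)‖ ≤ δ / 8 * ‖x' - x‖)
    {x : X} {k : Z} (hk : k ∈ K) (hkz : ‖k - z‖ ≤ δ / 8)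
    (hρ : ‖F x - k‖ ≤ δ) (hx : ‖x - x₀‖ + ‖F x - k‖ / δ ≤ R) :
    ∃ (x' : X) (k' : Z), k' ∈ K ∧ ‖x' - x‖ ≤ ‖F x - k‖ / δ ∧ ‖k' - k‖ ≤ 2 * (‖F x - k‖ / δ) ∧
      ‖F x' - k'‖ ≤ ‖F x - k‖ / 2 := by
  rcases (norm_nonneg (F x - k)).eq_or_lt with h0 | h0
  · exact ⟨x, k, hk, by simp [← h0], by simp [← h0], by simp [← h0]⟩
  set ρ := ‖F x - k‖ with hρdef
  set α := ρ / δ with hα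
  have hα0 : 0 < α := by positivity
  have hα1 : α ≤ 1 := by rw [hα, div_le_one hδ]; exact hρ
  have hαρ : α * δ = ρ := by rw [hα]; field_simp
  -- The residual is rescaled to norm `δ`, the largest that `hA` admits; the step is scaled back by
  -- `α`.
  obtain ⟨v, q, hv, hq, hqz, hvq⟩ := hA (-(α⁻¹ • (F x - k)))
    (by
      rw [norm_neg, norm_smul, norm_inv, Real.norm_of_nonneg hα0.le, ← hρdef, ← hαρ]
      apply le_of_eq; field_simp) (δ / 4) (by positivity)
  have hαv : ‖α • v‖ ≤ α := by
    rw [norm_smul, Real.norm_of_nonneg hα0.le]; nlinarith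
  refine ⟨x + α • v, k + α • (q - k), ?_, by simpa using hαv, ?_, ?_⟩
  · have := hK hk hq (a := 1 - α) (b := α) (by linarith) hα0.le (by ring)
    convert this using 1
    module
  · rw [add_sub_cancel_left, norm_smul, Real.norm_of_nonneg hα0.le]
    have : ‖q - k‖ ≤ 2 := by
      have h := norm_sub_le (q - z) (k - z)
      rw [sub_sub_sub_cancel_right] at h
      linarith
    nlinarith
  · have hx0 : ‖x - x₀‖ ≤ R := by linarith
    have hx1 : ‖x + α • v - x₀‖ ≤ R := by
      have := norm_add_le (x - x₀) (α • v)
      rw [show x + α • v - x₀ = x - x₀ + α • v by abel]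
      linarith
    have hlin := hF x (by rwa [mem_closedBall_iff_norm]) (x + α • v)
      (by rwa [mem_closedBall_iff_norm])
    rw [add_sub_cancel_left] at hlin
    -- The three terms are at most `α δ / 8`, `α δ / 8` and `α δ / 4`, in total `ρ / 2`.
    have hid : F (x + α • v) - (k + α • (q - k)) =
        (F (x + α • v) - F x - A (α • v)) + α • (k - z)
        - α • (-(α⁻¹ • (F x - k)) - (A v - (q - z))) := by
      rw [map_smul, smul_sub α (-(α⁻¹ • (F x - k))), smul_neg, smul_smul,
        mul_inv_cancel₀ hα0.ne', one_smul]
      module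
    rw [hid]
    have e1 : ‖α • (k - z)‖ ≤ α * (δ / 8) := by
      rw [norm_smul, Real.norm_of_nonneg hα0.le]; gcongr
    have e2 : ‖α • (-(α⁻¹ • (F x - k)) - (A v - (q - z)))‖ ≤ α * (δ / 4) := by
      rw [norm_smul, Real.norm_of_nonneg hα0.le]; gcongr
    have e3 : δ / 8 * ‖α • v‖ ≤ δ / 8 * α := by gcongr
    have t1 := norm_sub_le ((F (x + α • v) - F x - A (α • v)) + α • (k - z))
      (α • (-(α⁻¹ • (F x - k)) - (A v - (q - z))))
    have t2 := norm_add_le (F (x + α • v) - F x - A (α • v)) (α • (k - z))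
    linarith

/-- A constraint `F x ∈ K` with `F` close to an affine map whose linear part satisfies the
constraint qualification can be restored with a step proportional to the residual. -/
theorem NearlyOpen.exists_mem_preimage [CompleteSpace X] [CompleteSpace Z]
    {A : X →L[ℝ] Z} {K : Set Z} (hKc : IsClosed K) (hK : Convex ℝ K) {z : Z} {δ : ℝ}
    (hδ : 0 < δ) (hδ1 : δ ≤ 1) (hA : NearlyOpen A K z δ) {F : X → Z} {x₀ : X} {R : ℝ}
    (hFc : Continuous F)
    (hF : ∀ x ∈ Metric.closedBall x₀ R, ∀ x' ∈ Metric.closedBall x₀ R,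
      ‖F x' - F x - A (x' - x)‖ ≤ δ / 8 * ‖x' - x‖)
    {k₀ : Z} (hk₀ : k₀ ∈ K) (hk₀z : ‖k₀ - z‖ ≤ δ / 16)
    (hρ : ‖F x₀ - k₀‖ ≤ δ ^ 2 / 64) (hR : 2 * (‖F x₀ - k₀‖ / δ) ≤ R) :
    ∃ y : X, F y ∈ K ∧ ‖y - x₀‖ ≤ 2 / δ * ‖F x₀ - k₀‖ := by
  set ρ := ‖F x₀ - k₀‖ with hρdef
  have hρ0 : 0 ≤ ρ := norm_nonneg _
  set σ := ρ / δ with hσ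
  have hσ0 : 0 ≤ σ := by positivity
  have hσδ : σ * δ = ρ := by rw [hσ]; field_simp
  have hσ1 : σ ≤ δ / 64 := by rw [hσ, div_le_iff₀ hδ]; nlinarith
  -- The displacements are geometric partial sums: `2 σ ≤ R` keeps the iterates in the ball, and `4
  -- σ ≤ δ / 16` keeps `k` within `δ / 8` of `z`.
  let P : ℕ → X × Z → Prop := fun n p => p.2 ∈ K ∧ ‖F p.1 - p.2‖ ≤ ρ * (1 / 2) ^ n ∧
    ‖p.1 - x₀‖ ≤ 2 * σ * (1 - (1 / 2) ^ n) ∧ ‖p.2 - k₀‖ ≤ 4 * σ * (1 - (1 / 2) ^ n)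
  have step : ∀ n (p : {p // P n p}), ∃ p' : {p // P (n + 1) p},
      ‖p'.1.1 - p.1.1‖ ≤ σ * (1 / 2) ^ n ∧ ‖p'.1.2 - p.1.2‖ ≤ 2 * σ * (1 / 2) ^ n := by
    rintro n ⟨⟨x, k⟩, hk, hr, hx, hkk⟩
    dsimp only at hk hr hx hkk
    have hp0 : (0 : ℝ) < (1 / 2) ^ n := by positivity
    have hp1 : ((1 : ℝ) / 2) ^ n ≤ 1 := pow_le_one₀ (by norm_num) (by norm_num)
    have hr' : ‖F x - k‖ / δ ≤ σ * (1 / 2) ^ n := by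
      rw [div_le_iff₀ hδ]; nlinarith
    have hkz : ‖k - z‖ ≤ δ / 8 := by
      have := norm_add_le (k - k₀) (k₀ - z)
      rw [sub_add_sub_cancel] at this
      nlinarith
    obtain ⟨x', k', hk', hxx, hkk', hr2⟩ := hA.newton_step hK hδ hδ1 hF hk hkz
      (by nlinarith) (by nlinarith)
    have hpow : ((1 : ℝ) / 2) ^ (n + 1) = (1 / 2) ^ n / 2 := by rw [pow_succ]; ring
    refine ⟨⟨(x', k'), hk', ?_, ?_, ?_⟩, by dsimp only; linarith, by dsimp only; linarith⟩
    · dsimp only; rw [hpow]; linarith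
    · dsimp only; rw [hpow]
      have := norm_add_le (x' - x) (x - x₀)
      rw [sub_add_sub_cancel] at this
      linarith
    · dsimp only; rw [hpow]
      have := norm_add_le (k' - k) (k - k₀)
      rw [sub_add_sub_cancel] at this
      linarith
  choose next hnext using step
  let s : (n : ℕ) → {p // P n p} := fun n => Nat.rec
    (⟨(x₀, k₀), hk₀, by simp [ρ], by simp, by simp⟩ : {p // P 0 p}) (fun n p => next n p) n
  have hx : CauchySeq fun n => (s n).1.1 :=
    cauchySeq_of_le_geometric (1 / 2) σ (by norm_num) fun n => by
      rw [dist_comm, dist_eq_norm]; exact (hnext n (s n)).1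
  have hk : CauchySeq fun n => (s n).1.2 :=
    cauchySeq_of_le_geometric (1 / 2) (2 * σ) (by norm_num) fun n => by
      rw [dist_comm, dist_eq_norm]; exact (hnext n (s n)).2
  obtain ⟨y, hy⟩ := cauchySeq_tendsto_of_complete hx
  obtain ⟨k, hk⟩ := cauchySeq_tendsto_of_complete hk
  have hkK : k ∈ K := hKc.mem_of_tendsto hk (Eventually.of_forall fun n => (s n).2.1)
  have hFy : F y = k := by
    have h1 : Tendsto (fun n => F (s n).1.1 - (s n).1.2) atTop (𝓝 (F y - k)) :=
      ((hFc.tendsto y).comp hy).sub hk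
    have h2 : Tendsto (fun n => F (s n).1.1 - (s n).1.2) atTop (𝓝 0) := by
      refine squeeze_zero_norm (fun n => (s n).2.2.1) ?_
      simpa using (tendsto_pow_atTop_nhds_zero_of_lt_one (r := (1 : ℝ) / 2) (by norm_num)
        (by norm_num)).const_mul ρ
    exact sub_eq_zero.1 (tendsto_nhds_unique h1 h2)
  refine ⟨y, hFy ▸ hkK, ?_⟩
  have hlim : Tendsto (fun n => ‖(s n).1.1 - x₀‖) atTop (𝓝 ‖y - x₀‖) := (hy.sub_const x₀).norm
  have hb : ‖y - x₀‖ ≤ 2 * σ := le_of_tendsto' hlim fun n => by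
    have hp0 : (0 : ℝ) < (1 / 2) ^ n := by positivity
    have := (s n).2.2.2.1
    nlinarith
  calc ‖y - x₀‖ ≤ 2 * σ := hb
    _ = 2 / δ * ρ := by rw [hσ]; ring

theorem NearlyOpen.mono {A : X →L[ℝ] Z} {K : Set Z} {z : Z} {δ δ' : ℝ} (h : NearlyOpen A K z δ)
    (hle : δ' ≤ δ) : NearlyOpen A K z δ' := fun y hy => h y (hy.trans hle)

theorem mem_radialCone_of_add_mem {K : Set Z} (hK : Convex ℝ K) {z w : Z} (hz : z ∈ K)
    (hw : z + w ∈ K) : w ∈ radialCone K z :=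
  ⟨1, one_pos, fun _ ht => hK.add_smul_mem hz hw ht⟩

theorem smul_mem_radialCone {K : Set Z} {z w : Z} (hw : w ∈ radialCone K z) {a : ℝ}
    (ha : 0 < a) : a • w ∈ radialCone K z := by
  obtain ⟨T, hT, h⟩ := hw
  refine ⟨T / a, by positivity, fun t ht => ?_⟩
  rw [smul_smul]
  exact h _ ⟨mul_nonneg ht.1 ha.le, (le_div_iff₀ ha).1 ht.2⟩

/-- Under the constraint qualification, every vector splits as `A v - w` with `w` a radial
direction and `v` bounded linearly. -/
theorem exists_bounded_decomposition [CompleteSpace X] [CompleteSpace Z] (A : X →L[ℝ] Z)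
    {K : Set Z} (hKc : IsClosed K) (hK : Convex ℝ K) {z : Z} (hz : z ∈ K)
    (hCQ : range A - radialCone K z = univ) :
    ∃ M : ℝ, 0 < M ∧ ∀ e : Z, ∃ v : X, ∃ w ∈ radialCone K z, e = A v - w ∧ ‖v‖ ≤ M * ‖e‖ := by
  obtain ⟨δ', hδ', hA'⟩ := exists_nearlyOpen A hK hCQ
  set δ := min δ' 1
  have hδ : 0 < δ := lt_min hδ' one_pos
  have hA : NearlyOpen A K z δ := hA'.mono (min_le_left _ _)
  refine ⟨2 / δ, by positivity, fun e => ?_⟩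
  rcases eq_or_ne e 0 with rfl | he
  · exact ⟨0, 0, ⟨1, one_pos, fun t _ => by simpa using hz⟩, by simp, by simp⟩
  have hn : 0 < ‖e‖ := norm_pos_iff.2 he
  -- `e` is scaled to the largest admissible residual. Then `z + A v - a • e ∈ K` makes `A v - a •
  -- e` radial by convexity.
  set a := δ ^ 2 / 64 / ‖e‖ with ha
  have ha0 : 0 < a := by positivity
  have hae : ‖a • e‖ = δ ^ 2 / 64 := by
    rw [norm_smul, Real.norm_of_nonneg ha0.le, ha]; field_simp
  have hres : ‖z + A 0 - a • e - z‖ = ‖a • e‖ := by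
    rw [map_zero, add_zero, sub_sub_cancel_left, norm_neg]
  obtain ⟨v, hv, hvn⟩ := hA.exists_mem_preimage hKc hK hδ (min_le_right _ _)
    (F := fun x => z + A x - a • e) (x₀ := 0) (R := 2 * (δ ^ 2 / 64 / δ)) (by fun_prop)
    (fun x _ x' _ => by
      rw [show z + A x' - a • e - (z + A x - a • e) - A (x' - x) = 0 by rw [map_sub]; abel,
        norm_zero]
      positivity) hz (by rw [sub_self, norm_zero]; positivity)
    (by rw [hres, hae]) (by rw [hres, hae])
  rw [hres, sub_zero] at hvn
  refine ⟨a⁻¹ • v, a⁻¹ • (A v - a • e), smul_mem_radialCone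
    (mem_radialCone_of_add_mem hK hz (by rwa [← add_sub_assoc])) (by positivity), ?_, ?_⟩
  · rw [map_smul, smul_sub, smul_smul, inv_mul_cancel₀ ha0.ne', one_smul, sub_sub_cancel]
  · rw [norm_smul, norm_inv, Real.norm_of_nonneg ha0.le, inv_mul_le_iff₀ ha0]
    rw [norm_smul, Real.norm_of_nonneg ha0.le] at hvn
    linarith

/-- Metric regularity of the constraint `G x ∈ K` under the constraint qualification. -/
theorem exists_metric_regularity [CompleteSpace X] [CompleteSpace Z] {G : X → Z}
    (hG : ContDiff ℝ 2 G) {K : Set Z} (hKc : IsClosed K) (hK : Convex ℝ K) {x₀ : X}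
    (hCQ : range (fderiv ℝ G x₀) - radialCone K (G x₀) = univ) :
    ∃ M : ℝ, 0 < M ∧ ∃ η : ℝ, 0 < η ∧ ∀ x : X, ‖x - x₀‖ ≤ η → ∀ k ∈ K, ‖G x - k‖ ≤ η →
      ∃ y : X, G y ∈ K ∧ ‖y - x‖ ≤ M * ‖G x - k‖ := by
  obtain ⟨δ', hδ', hA'⟩ := exists_nearlyOpen (fderiv ℝ G x₀) hK hCQ
  set δ := min δ' 1
  have hδ : 0 < δ := lt_min hδ' one_pos
  have hA : NearlyOpen (fderiv ℝ G x₀) K (G x₀) δ := hA'.mono (min_le_left _ _)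
  have hs : HasStrictFDerivAt G (fderiv ℝ G x₀) x₀ :=
    hG.contDiffAt.hasStrictFDerivAt (by norm_num)
  obtain ⟨U, hU, hUapp⟩ := hs.approximates_deriv_on_nhds (c := (δ / 8).toNNReal)
    (Or.inr (Real.toNNReal_pos.2 (by positivity)))
  rw [ApproximatesLinearOn, Real.coe_toNNReal _ (by positivity)] at hUapp
  obtain ⟨R, hR, hball⟩ := Metric.nhds_basis_closedBall.mem_iff.1 hU
  obtain ⟨η₁, hη₁, hcont⟩ := Metric.continuousAt_iff.1 (hG.continuous.continuousAt (x := x₀))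
    (δ / 32) (by positivity)
  -- Two contributions `δ / 32` put `k` within `δ / 16` of `G x₀`; `R * δ / 4` keeps the total
  -- displacement within `R / 2`.
  refine ⟨2 / δ, by positivity, min (min (η₁ / 2) (R / 2)) (min (min (δ / 32) (δ ^ 2 / 64))
    (R * δ / 4)), by positivity, fun x hx k hk hxk => ?_⟩
  simp only [le_min_iff] at hx hxk
  have hGx : ‖G x - G x₀‖ < δ / 32 := by
    rw [← dist_eq_norm]; exact hcont (by rw [dist_eq_norm]; linarith [hx.1.1])
  have hsub : Metric.closedBall x (R / 2) ⊆ U := by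
    refine (Metric.closedBall_subset_closedBall' ?_).trans hball
    rw [dist_eq_norm]; linarith [hx.1.2]
  refine hA.exists_mem_preimage hKc hK hδ (min_le_right _ _) (R := R / 2) hG.continuous
    (fun u hu u' hu' => hUapp _ (hsub hu') _ (hsub hu)) hk ?_ hxk.2.1.2 ?_
  · have := norm_sub_le (G x - G x₀) (G x - k)
    rw [sub_sub_sub_cancel_left] at this
    linarith [hxk.2.1.1]
  · have : ‖G x - k‖ / δ ≤ R / 4 := by
      rw [div_le_iff₀ hδ]; linarith [hxk.2.2]
    linarith

end Regularity

theorem DecreasesToZero.comp {t : ℕ → ℝ} (ht : DecreasesToZero t) {φ : ℕ → ℕ}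
    (hφ : Tendsto φ atTop atTop) : DecreasesToZero (t ∘ φ) :=
  ⟨fun k => ht.1 (φ k), ht.2.comp hφ⟩

/-! ### Second-order Taylor expansion of the constraint map -/

section Taylor

variable {X Z : Type*} [NormedAddCommGroup X] [NormedSpace ℝ X]
  [NormedAddCommGroup Z] [NormedSpace ℝ Z]

theorem continuous_secondDerivSq (G : X → Z) (x : X) : Continuous (secondDerivSq G x) := by
  unfold secondDerivSq; fun_prop

theorem secondDerivSq_smul (G : X → Z) (x : X) (t : ℝ) (h : X) :
    secondDerivSq G x (t • h) = t ^ 2 • secondDerivSq G x h := by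
  simp [secondDerivSq, smul_smul, sq]

/-- Mean value inequality for `y ↦ G (x₀ + y) - ½ B y y`: by symmetry of `B` its derivative is
`G'(x₀ + y) - B y`, which stays within `ε ‖w‖` of `G'(x₀)` on the ball of radius `‖w‖`. -/
theorem taylor_secondDerivSq {G : X → Z} (hG : ContDiff ℝ 2 G) (x₀ : X) {ε : ℝ} (hε : 0 < ε) :
    ∃ δ : ℝ, 0 < δ ∧ ∀ w : X, ‖w‖ < δ →
      ‖G (x₀ + w) - G x₀ - fderiv ℝ G x₀ w - (1 / 2 : ℝ) • secondDerivSq G x₀ w‖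
        ≤ ε * ‖w‖ ^ 2 := by
  have hd1 : Differentiable ℝ G := hG.differentiable (by norm_num)
  have hd2 : HasFDerivAt (fderiv ℝ G) (fderiv ℝ (fderiv ℝ G) x₀) x₀ :=
    ((hG.fderiv_right (m := 1) (by norm_num)).differentiable (by norm_num) x₀).hasFDerivAt
  have hsymm : IsSymmSndFDerivAt ℝ G x₀ := hG.contDiffAt.isSymmSndFDerivAt (by simp)
  set B := fderiv ℝ (fderiv ℝ G) x₀ with hB
  have hlo := hd2.isLittleO.def hε
  obtain ⟨δ, hδ, hball⟩ := Metric.eventually_nhds_iff.1 hlo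
  refine ⟨δ, hδ, fun w hw => ?_⟩
  have hder : ∀ y ∈ Metric.closedBall (0 : X) ‖w‖,
      HasFDerivWithinAt (fun y => G (x₀ + y) - (1 / 2 : ℝ) • B y y)
        (fderiv ℝ G (x₀ + y) - B y) (Metric.closedBall 0 ‖w‖) y := fun y _ => by
    have h1 : HasFDerivAt (fun y => G (x₀ + y)) (fderiv ℝ G (x₀ + y)) y :=
      (hd1 (x₀ + y)).hasFDerivAt.comp y ((hasFDerivAt_id y).const_add x₀)
    have h2 : HasFDerivAt (fun y => (1 / 2 : ℝ) • B y y) (B y) y := by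
      have h3 := ((B.hasFDerivAt (x := y)).clm_apply (hasFDerivAt_id y)).const_smul (1 / 2 : ℝ)
      refine h3.congr_fderiv ?_
      ext v
      have := hsymm v y
      rw [← hB] at this
      simp only [smul_apply, add_apply,
        ContinuousLinearMap.comp_apply, ContinuousLinearMap.id_apply,
        ContinuousLinearMap.flip_apply, id, this]
      module
    exact (h1.sub h2).hasFDerivWithinAt
  have hbound : ∀ y ∈ Metric.closedBall (0 : X) ‖w‖,
      ‖fderiv ℝ G (x₀ + y) - B y - fderiv ℝ G x₀‖ ≤ ε * ‖w‖ := fun y hy => by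
    rw [mem_closedBall_zero_iff] at hy
    have := hball (y := x₀ + y) (by simpa using hy.trans_lt hw)
    rw [add_sub_cancel_left] at this
    rw [sub_right_comm]
    exact this.trans (by gcongr)
  have := (convex_closedBall (0 : X) ‖w‖).norm_image_sub_le_of_norm_hasFDerivWithin_le' hder hbound
    (x := 0) (y := w) (by simp) (by simp)
  simp only [add_zero, map_zero, smul_zero, sub_zero] at this
  rw [sq, ← mul_assoc]
  convert this using 2
  unfold secondDerivSq
  abel

/-- Second-order expansion of `G` along a bounded sequence of directions. -/
theorem tendsto_taylor_remainder {G : X → Z} (hG : ContDiff ℝ 2 G) (x₀ : X) {t : ℕ → ℝ}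
    (ht : DecreasesToZero t) {u : ℕ → X} {b : ℝ} (hu : ∀ k, ‖u k‖ ≤ b) :
    Tendsto (fun k => (t k ^ 2)⁻¹ • (G (x₀ + t k • u k) - G x₀ - t k • fderiv ℝ G x₀ (u k)
      - (1 / 2 * t k ^ 2 : ℝ) • secondDerivSq G x₀ (u k))) atTop (𝓝 0) := by
  have hb : 0 ≤ b := (norm_nonneg _).trans (hu 0)
  rw [Metric.tendsto_nhds]
  intro ε hε
  obtain ⟨δ, hδ, hT⟩ := taylor_secondDerivSq hG x₀ (ε := ε / (2 * (b ^ 2 + 1))) (by positivity)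
  have hsmall : Tendsto (fun k => t k * b) atTop (𝓝 0) := by simpa using ht.2.mul_const b
  filter_upwards [hsmall.eventually_lt_const hδ] with k hk
  have htk := ht.1 k
  have hn : ‖t k • u k‖ ≤ t k * b := by
    rw [norm_smul, Real.norm_of_nonneg htk.le]; gcongr; exact hu k
  have h := hT (t k • u k) (hn.trans_lt hk)
  rw [secondDerivSq_smul, map_smul, smul_smul] at h
  rw [dist_zero_right, norm_smul, norm_inv, Real.norm_of_nonneg (by positivity),
    inv_mul_lt_iff₀ (by positivity)]
  calc _ ≤ ε / (2 * (b ^ 2 + 1)) * (t k * b) ^ 2 := h.trans (by gcongr)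
    _ = t k ^ 2 * (ε * (b ^ 2 / (2 * (b ^ 2 + 1)))) := by ring
    _ < t k ^ 2 * ε := by
      have : b ^ 2 / (2 * (b ^ 2 + 1)) < 1 := by
        rw [div_lt_one (by positivity)]; nlinarith
      have : ε * (b ^ 2 / (2 * (b ^ 2 + 1))) < ε := by nlinarith
      gcongr

end Taylor

/-! ### Second-order tangent sets -/

section SecondTangent

variable {E : Type*} [NormedAddCommGroup E] [NormedSpace ℝ E]

theorem exists_seq_of_mem_secondTangentSet {C : Set E} (hC : C.Nonempty) {x h q : E}
    (hq : q ∈ secondTangentSet C x h) :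
    ∃ (t : ℕ → ℝ) (r : ℕ → E), DecreasesToZero t ∧ Tendsto r atTop (𝓝 q) ∧
      ∀ n, x + t n • h + ((1 / 2 : ℝ) * t n ^ 2) • r n ∈ C := by
  obtain ⟨t, ht, hlim⟩ := hq
  -- Nearest points need not exist; the slack `t n ^ 3` is `o(t n ^ 2)`.
  have hex : ∀ n, ∃ y ∈ C, dist (x + t n • h + ((1 / 2 : ℝ) * t n ^ 2) • q) y <
      Metric.infDist (x + t n • h + ((1 / 2 : ℝ) * t n ^ 2) • q) C + t n ^ 3 := fun n =>
    (Metric.infDist_lt_iff hC).1 (lt_add_of_pos_right _ (pow_pos (ht.1 n) 3))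
  choose y hyC hy using hex
  have hne : ∀ n, (1 / 2 : ℝ) * t n ^ 2 ≠ 0 := fun n => by have := ht.1 n; positivity
  refine ⟨t, fun n => ((1 / 2 : ℝ) * t n ^ 2)⁻¹ • (y n - (x + t n • h)), ht, ?_, fun n => ?_⟩
  · rw [tendsto_iff_norm_sub_tendsto_zero]
    have hl : Tendsto (fun n => 2 * (Metric.infDist (x + t n • h + ((1 / 2 : ℝ) * t n ^ 2) • q) C
        / t n ^ 2 + t n)) atTop (𝓝 0) := by
      simpa using (hlim.add ht.2).const_mul 2
    refine squeeze_zero (fun _ => norm_nonneg _) (fun n => ?_) hl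
    have htn := ht.1 n
    have hid : ((1 / 2 : ℝ) * t n ^ 2)⁻¹ • (y n - (x + t n • h)) - q =
        ((1 / 2 : ℝ) * t n ^ 2)⁻¹ • (y n - (x + t n • h + ((1 / 2 : ℝ) * t n ^ 2) • q)) := by
      rw [← sub_sub (y n) (x + t n • h), smul_sub _ (y n - (x + t n • h)), smul_smul, inv_mul_cancel₀ (hne n), one_smul]
    rw [hid, norm_smul, norm_inv, Real.norm_of_nonneg (by positivity),
      inv_mul_le_iff₀ (by positivity), ← dist_eq_norm, dist_comm]
    refine (hy n).le.trans (le_of_eq ?_)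
    field_simp
  · dsimp only
    rw [smul_smul, mul_inv_cancel₀ (hne n), one_smul, add_sub_cancel]
    exact hyC n

theorem mem_secondTangentSet_of_tendsto {C : Set E} {x h q : E} {t : ℕ → ℝ} {r : ℕ → E}
    (ht : DecreasesToZero t) (hr : Tendsto r atTop (𝓝 q))
    (hC : ∀ᶠ n in atTop, x + t n • h + ((1 / 2 : ℝ) * t n ^ 2) • r n ∈ C) :
    q ∈ secondTangentSet C x h := by
  refine ⟨t, ht, ?_⟩
  have hl : Tendsto (fun n => 1 / 2 * ‖q - r n‖) atTop (𝓝 0) := by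
    simpa using (hr.const_sub q).norm.const_mul (1 / 2 : ℝ)
  refine squeeze_zero' (Eventually.of_forall fun n => ?_) ?_ hl
  · exact div_nonneg Metric.infDist_nonneg (sq_nonneg _)
  · filter_upwards [hC] with n hn
    have htn := ht.1 n
    rw [div_le_iff₀ (by positivity)]
    refine (Metric.infDist_le_dist_of_mem hn).trans (le_of_eq ?_)
    rw [dist_eq_norm, add_sub_add_left_eq_sub, ← smul_sub, norm_smul,
      Real.norm_of_nonneg (by positivity)]
    ring

/-- Mixing the arc with the fixed point `x + T w`, with weight `t² / (2 T)`, adds `½ t² w`; the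
other changes are `o(t²)`. -/
theorem add_mem_secondTangentSet {C : Set E} (hC : Convex ℝ C) (hne : C.Nonempty) {x h q w : E}
    (hq : q ∈ secondTangentSet C x h) (hw : w ∈ radialCone C x) :
    q + w ∈ secondTangentSet C x h := by
  obtain ⟨t, r, ht, hr, hmem⟩ := exists_seq_of_mem_secondTangentSet hne hq
  obtain ⟨T, hT, hTw⟩ := hw
  have h2 : Tendsto (fun n => t n ^ 2) atTop (𝓝 0) := by simpa using ht.2.pow 2
  refine mem_secondTangentSet_of_tendsto (t := t)
    (r := fun n => r n + w - (T⁻¹ * t n) • h - (T⁻¹ * (1 / 2) * t n ^ 2) • r n) ht ?_ ?_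
  · have h1 := (ht.2.const_mul T⁻¹).smul_const h
    have h3 := (h2.const_mul (T⁻¹ * (1 / 2))).smul hr
    simpa using ((hr.add_const w).sub h1).sub h3
  · have hs : Tendsto (fun n => 1 / 2 * t n ^ 2 * T⁻¹) atTop (𝓝 0) := by
      simpa only [mul_zero, zero_mul] using (h2.const_mul (1 / 2)).mul_const T⁻¹
    filter_upwards [hs.eventually_lt_const one_pos] with n hn
    have htn := ht.1 n
    have := hC (hmem n) (hTw T ⟨hT.le, le_rfl⟩) (a := 1 - 1 / 2 * t n ^ 2 * T⁻¹)
      (b := 1 / 2 * t n ^ 2 * T⁻¹) (by linarith) (by positivity) (by ring)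
    convert this using 1
    have hw' : (1 / 2 * t n ^ 2 * T⁻¹) • (x + T • w) =
        (1 / 2 * t n ^ 2 * T⁻¹) • x + (1 / 2 * t n ^ 2) • w := by
      rw [smul_add, smul_smul, inv_mul_cancel_right₀ hT.ne']
    rw [hw']
    module

theorem SecondOrderRegular.exists_correction {C : Set E} {x h : E} (hC : SecondOrderRegular C x)
    (hh : h ∈ tangentCone C x) {t : ℕ → ℝ} {r : ℕ → E} (ht : DecreasesToZero t)
    (htr : Tendsto (fun n => t n • r n) atTop (𝓝 0))
    (hmem : ∀ n, x + t n • h + ((1 / 2 : ℝ) * t n ^ 2) • r n ∈ C) :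
    ∃ e : ℕ → E, Tendsto e atTop (𝓝 0) ∧
      ∀ᶠ n in atTop, r n + e n ∈ secondTangentSet C x h := by
  have hd := hC h hh t r ht htr hmem
  -- The premise allows a choice for every `n`; it holds eventually because the distances tend to
  -- zero.
  have hex : ∀ n, ∃ q : E, Metric.infEDist (r n) (secondTangentSet C x h) < ⊤ →
      q ∈ secondTangentSet C x h ∧
      edist (r n) q ≤ Metric.infEDist (r n) (secondTangentSet C x h) + ENNReal.ofReal (t n) := by
    intro n
    by_cases hn : Metric.infEDist (r n) (secondTangentSet C x h) < ⊤
    · obtain ⟨q, hq, hlt⟩ := Metric.infEDist_lt_iff.1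
        (ENNReal.lt_add_right hn.ne (ENNReal.ofReal_pos.2 (ht.1 n)).ne')
      exact ⟨q, fun _ => ⟨hq, hlt.le⟩⟩
    · exact ⟨0, fun h => absurd h hn⟩
  choose q hq using hex
  have hfin : ∀ᶠ n in atTop, Metric.infEDist (r n) (secondTangentSet C x h) < ⊤ :=
    hd.eventually_lt_const ENNReal.zero_lt_top
  refine ⟨fun n => q n - r n, ?_, ?_⟩
  · rw [tendsto_iff_edist_tendsto_0]
    have hl : Tendsto (fun n => Metric.infEDist (r n) (secondTangentSet C x h)
        + ENNReal.ofReal (t n)) atTop (𝓝 0) := by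
      simpa using hd.add (ENNReal.tendsto_ofReal ht.2)
    refine tendsto_of_tendsto_of_tendsto_of_le_of_le' tendsto_const_nhds hl
      (Eventually.of_forall fun _ => zero_le) ?_
    filter_upwards [hfin] with n hn
    rw [edist_zero_right, ← ofReal_norm, norm_sub_rev, ← dist_eq_norm, ← edist_dist]
    exact (hq n hn).2
  · filter_upwards [hfin] with n hn
    rw [add_sub_cancel]
    exact (hq n hn).1

end SecondTangent

/-! ### Weak-⋆ convergence -/

section WeakStar

variable {X Y : Type*} [NormedAddCommGroup X] [NormedSpace ℝ X]
  [NormedAddCommGroup Y] [NormedSpace ℝ Y]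

theorem weakStarTendsto_of_tendsto (d : X ≃ₗᵢ[ℝ] StrongDual ℝ Y) {u : ℕ → X} {x : X}
    (h : Tendsto u atTop (𝓝 x)) : WeakStarTendsto d u x := fun y =>
  (((ContinuousLinearMap.apply ℝ ℝ y).continuous.comp d.continuous).tendsto x).comp h

theorem WeakStarTendsto.tendsto_apply {d : X ≃ₗᵢ[ℝ] StrongDual ℝ Y} {u : ℕ → X} {x : X}
    (h : WeakStarTendsto d u x) {f : StrongDual ℝ X} (hf : f ∈ range (canonicalEmbedding d)) :
    Tendsto (fun k => f (u k)) atTop (𝓝 (f x)) := by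
  obtain ⟨y, rfl⟩ := hf
  exact h y

theorem tangentCone_subset_weakStarTangentCone (d : X ≃ₗᵢ[ℝ] StrongDual ℝ Y) (C : Set X) (x : X) :
    tangentCone C x ⊆ weakStarTangentCone d C x := by
  rintro h ⟨t, xs, ht, hxs, hlim⟩
  exact ⟨t, xs, ht, hxs, weakStarTendsto_of_tendsto d hlim⟩

theorem exists_weakStar_convergent_subsequence [TopologicalSpace.SeparableSpace Y]
    (d : X ≃ₗᵢ[ℝ] StrongDual ℝ Y) {u : ℕ → X} {b : ℝ} (hu : ∀ k, ‖u k‖ ≤ b) :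
    ∃ (x : X) (φ : ℕ → ℕ), StrictMono φ ∧ WeakStarTendsto d (u ∘ φ) x := by
  obtain ⟨a, -, φ, hφ, hlim⟩ := WeakDual.isSeqCompact_closedBall ℝ Y 0 b
    (x := fun k => StrongDual.toWeakDual (d (u k)))
    (fun k => by simpa using hu k)
  refine ⟨d.symm (WeakDual.toStrongDual a), φ, hφ, fun y => ?_⟩
  have := ((WeakDual.eval_continuous y).tendsto a).comp hlim
  simp only [LinearIsometryEquiv.apply_symm_apply]
  exact this

end WeakStar

theorem zero_lt_coe_add_iff (a : ℝ) (q : EReal) :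
    (0 : EReal) < (a : EReal) + q ↔ ((-a : ℝ) : EReal) < q := by
  induction q with
  | bot => simp
  | top => simpa using EReal.coe_lt_top (-a)
  | coe q => norm_cast; constructor <;> intro h <;> linarith

/-! ### Second-order conditions, growth and curvature -/

section Conditions

variable {X Z : Type*} [NormedAddCommGroup X] [NormedSpace ℝ X]
  [NormedAddCommGroup Z] [NormedSpace ℝ Z]

theorem mem_preimage_sub_singleton_iff {A : X →L[ℝ] Z} {T : Set Z} {s : Z} {r : X} :
    r ∈ A ⁻¹' (T - {s}) ↔ A r + s ∈ T := by
  rw [mem_preimage, sub_singleton, mem_image]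
  constructor
  · rintro ⟨q, hq, h⟩
    rwa [← h, sub_add_cancel]
  · exact fun h => ⟨_, h, add_sub_cancel_right _ _⟩

/-- Along `x₀ + t h + ½ t² r` the map `G` misses points of `K` by only `o(t²)`. Metric regularity
repairs this by a displacement `o(t²)`, which is absorbed into `r`. -/
theorem exists_feasible_arc [CompleteSpace X] [CompleteSpace Z] {G : X → Z}
    (hG : ContDiff ℝ 2 G) {K : Set Z} (hKc : IsClosed K) (hK : Convex ℝ K) (hne : K.Nonempty)
    {x₀ : X} (hCQ : range (fderiv ℝ G x₀) - radialCone K (G x₀) = univ) {h r : X}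
    (hr : fderiv ℝ G x₀ r + secondDerivSq G x₀ h ∈
      secondTangentSet K (G x₀) (fderiv ℝ G x₀ h)) :
    ∃ (t : ℕ → ℝ) (ρ : ℕ → X), DecreasesToZero t ∧ Tendsto ρ atTop (𝓝 r) ∧
      ∀ n, G (x₀ + t n • (h + (t n / 2) • ρ n)) ∈ K := by
  set A := fderiv ℝ G x₀ with hA
  set z := G x₀ with hz
  obtain ⟨t, q, ht, hq, hmem⟩ := exists_seq_of_mem_secondTangentSet hne hr
  obtain ⟨M, hM, η, hη, hreg⟩ := exists_metric_regularity hG hKc hK hCQ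
  set u : ℕ → X := fun n => h + (t n / 2) • r with hu
  have hut : Tendsto u atTop (𝓝 h) := by
    simpa using ((ht.2.div_const 2).smul_const r).const_add h
  obtain ⟨b, hb⟩ := hut.norm.bddAbove_range
  have hrem := tendsto_taylor_remainder hG x₀ ht (u := u) (b := b) fun k => hb ⟨k, rfl⟩
  set κ : ℕ → Z := fun n => z + t n • A h + ((1 / 2 : ℝ) * t n ^ 2) • q n with hκ
  have hres : Tendsto (fun n => (t n ^ 2)⁻¹ • (G (x₀ + t n • u n) - κ n)) atTop (𝓝 0) := by
    have h1 : Tendsto (fun n => (1 / 2 : ℝ) • (secondDerivSq G x₀ (u n) + A r - q n)) atTop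
        (𝓝 0) := by
      have := (((((continuous_secondDerivSq G x₀).tendsto h).comp hut).add_const (A r)).sub
        hq).const_smul (1 / 2 : ℝ)
      simpa [add_comm] using this
    have h2 := hrem.add h1
    rw [add_zero] at h2
    refine h2.congr fun n => ?_
    have htn : t n ^ 2 ≠ 0 := (pow_pos (ht.1 n) 2).ne'
    have h3 : (1 / 2 : ℝ) • (secondDerivSq G x₀ (u n) + A r - q n) =
        (t n ^ 2)⁻¹ • ((1 / 2 * t n ^ 2) • (secondDerivSq G x₀ (u n) + A r - q n)) := by
      rw [smul_smul, mul_left_comm, inv_mul_cancel₀ htn, mul_one]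
    rw [h3, ← smul_add]
    congr 1
    simp only [hκ, hu, map_add, map_smul]
    module
  have hx : Tendsto (fun n => x₀ + t n • u n) atTop (𝓝 x₀) := by
    simpa using (ht.2.smul hut).const_add x₀
  have hκt : Tendsto (fun n => G (x₀ + t n • u n) - κ n) atTop (𝓝 0) := by
    have := (ht.2.pow 2).smul hres
    simp only [ne_eq, OfNat.ofNat_ne_zero, not_false_eq_true, zero_pow, smul_zero] at this
    refine this.congr fun n => ?_
    rw [smul_smul, mul_inv_cancel₀ (pow_pos (ht.1 n) 2).ne', one_smul]
  have hev : ∀ᶠ n in atTop, ∃ y : X, G y ∈ K ∧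
      ‖y - (x₀ + t n • u n)‖ ≤ M * ‖G (x₀ + t n • u n) - κ n‖ := by
    filter_upwards [(tendsto_iff_norm_sub_tendsto_zero.1 hx).eventually_le_const hη,
      (tendsto_zero_iff_norm_tendsto_zero.1 hκt).eventually_le_const hη] with n h1 h2
    exact hreg _ h1 (κ n) (hmem n) h2
  obtain ⟨N, hN⟩ := eventually_atTop.1 hev
  choose y hyK hy using fun n : ℕ => hN (n + N) (Nat.le_add_left N n)
  have hshift : Tendsto (fun n : ℕ => n + N) atTop atTop := tendsto_add_atTop_nat N
  refine ⟨fun n => t (n + N),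
    fun n => r + (2 * (t (n + N) ^ 2)⁻¹) • (y n - (x₀ + t (n + N) • u (n + N))),
    ht.comp hshift, ?_, fun n => ?_⟩
  · have h0 : Tendsto (fun n => (2 * (t (n + N) ^ 2)⁻¹) • (y n - (x₀ + t (n + N) • u (n + N))))
        atTop (𝓝 0) := by
      have hl := ((tendsto_zero_iff_norm_tendsto_zero.1 hres).comp hshift).const_mul (2 * M)
      rw [mul_zero] at hl
      refine squeeze_zero_norm (fun n => ?_) hl
      have htn := ht.1 (n + N)
      rw [Function.comp_apply, norm_smul, norm_smul, Real.norm_of_nonneg (by positivity),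
        Real.norm_of_nonneg (by positivity)]
      calc _ ≤ 2 * (t (n + N) ^ 2)⁻¹ * (M * ‖G (x₀ + t (n + N) • u (n + N)) - κ (n + N)‖) := by
            gcongr; exact hy n
        _ = _ := by ring
    simpa using h0.const_add r
  · have htn := ht.1 (n + N)
    dsimp only
    convert hyK n using 2
    rw [smul_add (t (n + N) / 2), smul_smul (t (n + N) / 2), ← add_assoc h, smul_add (t (n + N)),
      smul_smul (t (n + N)) (t (n + N) / 2 * _),
      show t (n + N) * (t (n + N) / 2 * (2 * (t (n + N) ^ 2)⁻¹)) = 1 by field_simp, one_smul,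
      ← add_assoc, add_sub_cancel]

variable {Y : Type*} [NormedAddCommGroup Y] [NormedSpace ℝ Y]

theorem QuadraticGrowth.pullBackSSC [CompleteSpace X] [CompleteSpace Z]
    {d : X ≃ₗᵢ[ℝ] StrongDual ℝ Y} {G : X → Z} (hG : ContDiff ℝ 2 G) {K : Set Z}
    (hKc : IsClosed K) (hK : Convex ℝ K) (hne : K.Nonempty) {x₀ : X} {J : X → ℝ}
    {J₁ : StrongDual ℝ X} {J₂ : X →L[ℝ] X →L[ℝ] ℝ}
    (hJ : HasWeakStarTaylor d (G ⁻¹' K) J x₀ J₁ J₂)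
    (hCQ : range (fderiv ℝ G x₀) - radialCone K (G x₀) = univ)
    (hgrowth : QuadraticGrowth (G ⁻¹' K) J x₀) : PullBackSSC G K x₀ J₁ J₂ := by
  obtain ⟨c, hc, ε, hε, hgr⟩ := hgrowth
  rintro h ⟨⟨hJh, -⟩, hh0⟩
  have hn : 0 < ‖h‖ := norm_pos_iff.2 hh0
  have hJh : J₁ h = 0 := hJh
  rw [zero_lt_coe_add_iff]
  -- A bound independent of `r` keeps the inequality strict after the infimum, which may also be
  -- `⊤`.
  refine lt_of_lt_of_le (EReal.coe_lt_coe_iff.2 (show -J₂ h h < c * ‖h‖ ^ 2 - J₂ h h by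
    have : 0 < c * ‖h‖ ^ 2 := by positivity
    linarith)) (le_iInf₂ fun r hr => EReal.coe_le_coe_iff.2 ?_)
  rw [mem_preimage_sub_singleton_iff] at hr
  obtain ⟨t, ρ, ht, hρ, hmem⟩ := exists_feasible_arc hG hKc hK hne hCQ hr
  set u : ℕ → X := fun n => h + (t n / 2) • ρ n with hu
  have hut : Tendsto u atTop (𝓝 h) := by
    simpa using ((ht.2.div_const 2).smul hρ).const_add h
  have hquot := hJ.2 u t h ht (weakStarTendsto_of_tendsto d hut) hmem
  have hJ₂u : Tendsto (fun n => J₂ (u n) (u n)) atTop (𝓝 (J₂ h h)) :=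
    ((by fun_prop : Continuous fun x => J₂ x x).tendsto h).comp hut
  have hJ₁ρ : Tendsto (fun n => J₁ (ρ n)) atTop (𝓝 (J₁ r)) := (J₁.continuous.tendsto r).comp hρ
  have hx : Tendsto (fun n => t n • u n) atTop (𝓝 0) := by simpa using ht.2.smul hut
  have hlow : Tendsto (fun n => c / 2 * ‖u n‖ ^ 2) atTop (𝓝 (c / 2 * ‖h‖ ^ 2)) :=
    (hut.norm.pow 2).const_mul _
  have hup := (hquot.add (hJ₁ρ.const_mul (1 / 2))).add (hJ₂u.const_mul (1 / 2))
  have := le_of_tendsto_of_tendsto hlow hup (by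
    filter_upwards [(tendsto_zero_iff_norm_tendsto_zero.1 hx).eventually_le_const hε] with n hn
    have htn := ht.1 n
    have hg := hgr (x₀ + t n • u n) ⟨hmem n, by rw [mem_closedBall_iff_norm]; simpa using hn⟩
    rw [add_sub_cancel_left, norm_smul, Real.norm_of_nonneg htn.le] at hg
    have hJ₁u : J₁ (u n) = t n / 2 * J₁ (ρ n) := by simp [hu, hJh]
    rw [hJ₁u]
    have : c / 2 * ‖u n‖ ^ 2 ≤ (J (x₀ + t n • u n) - J x₀) / t n ^ 2 := by
      rw [le_div_iff₀ (by positivity)]; linarith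
    refine this.trans (le_of_eq ?_)
    field_simp
    ring)
  linarith

/-- Growth fails with constant and radius both `1 / (n + 1)`. Division by `t²` and the Taylor
expansion leave a quadratic model bounded above by a null sequence. -/
theorem exists_seq_of_not_quadraticGrowth [TopologicalSpace.SeparableSpace Y]
    {d : X ≃ₗᵢ[ℝ] StrongDual ℝ Y} {C : Set X} {x₀ : X} {J : X → ℝ} {J₁ : StrongDual ℝ X}
    {J₂ : X →L[ℝ] X →L[ℝ] ℝ} (hJ : HasWeakStarTaylor d C J x₀ J₁ J₂)
    (hgrowth : ¬ QuadraticGrowth C J x₀) :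
    ∃ (t : ℕ → ℝ) (u : ℕ → X) (h : X) (b : ℕ → ℝ), DecreasesToZero t ∧ (∀ k, ‖u k‖ = 1) ∧
      WeakStarTendsto d u h ∧ (∀ k, x₀ + t k • u k ∈ C) ∧ Tendsto b atTop (𝓝 0) ∧
      ∀ k, J₁ (u k) / t k + 1 / 2 * J₂ (u k) (u k) ≤ b k := by
  have hex : ∀ n : ℕ, ∃ x ∈ C ∩ Metric.closedBall x₀ (1 / ((n : ℝ) + 1)),
      J x < J x₀ + (1 / ((n : ℝ) + 1)) / 2 * ‖x - x₀‖ ^ 2 := by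
    intro n
    by_contra! hcon
    exact hgrowth ⟨_, by positivity, _, by positivity, hcon⟩
  choose x hxC hx using hex
  have hpos : ∀ n, 0 < ‖x n - x₀‖ := fun n => by
    rw [norm_pos_iff, sub_ne_zero]
    intro heq
    have := hx n
    simp [heq] at this
  have hτ : DecreasesToZero fun n => ‖x n - x₀‖ := ⟨hpos, squeeze_zero (fun _ => norm_nonneg _)
    (fun n => mem_closedBall_iff_norm.1 (hxC n).2) tendsto_one_div_add_atTop_nhds_zero_nat⟩
  set u : ℕ → X := fun n => ‖x n - x₀‖⁻¹ • (x n - x₀) with hu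
  have hu1 : ∀ n, ‖u n‖ = 1 := fun n => by
    rw [hu]; dsimp only
    rw [norm_smul, norm_inv, norm_norm, inv_mul_cancel₀ (hpos n).ne']
  have hxu : ∀ n, x₀ + ‖x n - x₀‖ • u n = x n := fun n => by
    rw [hu]; dsimp only
    rw [smul_smul, mul_inv_cancel₀ (hpos n).ne', one_smul, add_sub_cancel]
  obtain ⟨h, φ, hφ, hlim⟩ := exists_weakStar_convergent_subsequence d (fun k => (hu1 k).le)
  have hφt := hφ.tendsto_atTop
  have hmem : ∀ k, x₀ + ((fun n => ‖x n - x₀‖) ∘ φ) k • (u ∘ φ) k ∈ C := fun k => by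
    rw [Function.comp_apply, Function.comp_apply, hxu]; exact (hxC _).1
  have hquot := hJ.2 _ _ h (hτ.comp hφt) hlim hmem
  refine ⟨_, _, h, _, hτ.comp hφt, fun k => hu1 (φ k), hlim, hmem,
    by simpa only [mul_zero, sub_zero] using ((tendsto_one_div_add_atTop_nhds_zero_nat
      (𝕜 := ℝ)).comp hφt).const_mul (1 / 2) |>.sub hquot, fun k => ?_⟩
  have hp := hpos (φ k)
  have hlt := hx (φ k)
  simp only [Function.comp_apply, hxu]
  set τ := ‖x (φ k) - x₀‖
  have : (J (x (φ k)) - J x₀) / τ ^ 2 ≤ 1 / 2 * (1 / ((φ k : ℝ) + 1)) := by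
    rw [div_le_iff₀ (by positivity)]; linarith
  have hsplit : (J (x (φ k)) - J x₀ - τ * J₁ (u (φ k)) - 1 / 2 * τ ^ 2 * J₂ (u (φ k)) (u (φ k)))
      / τ ^ 2 = (J (x (φ k)) - J x₀) / τ ^ 2 -
        (J₁ (u (φ k)) / τ + 1 / 2 * J₂ (u (φ k)) (u (φ k))) := by
    field_simp
    ring
  linarith

theorem PullBackSSC.quadraticGrowth [CompleteSpace X] [CompleteSpace Z]
    [TopologicalSpace.SeparableSpace Y]
    {d : X ≃ₗᵢ[ℝ] StrongDual ℝ Y} {G : X → Z} (hG : ContDiff ℝ 2 G) {K : Set Z}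
    (hKc : IsClosed K) (hK : Convex ℝ K) {x₀ : X} (hx₀ : G x₀ ∈ K) {J : X → ℝ}
    {J₁ : StrongDual ℝ X} {J₂ : X →L[ℝ] X →L[ℝ] ℝ}
    (hJ : HasWeakStarTaylor d (G ⁻¹' K) J x₀ J₁ J₂)
    (hJ₁ : J₁ ∈ -weakStarNormalCone d (G ⁻¹' K) x₀)
    (hJ₂ : WeakStarLSC d (fun h => J₂ h h))
    (hNDC : NonDegenerate d (G ⁻¹' K) x₀ J₁ J₂)
    (hG₁ : WeakStarToStrongContinuous d (fun h => fderiv ℝ G x₀ h))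
    (hG₂ : WeakStarToStrongContinuous d (fun h => secondDerivSq G x₀ h))
    (hreg : SecondOrderRegular K (G x₀))
    (hCQ : range (fderiv ℝ G x₀) - radialCone K (G x₀) = univ)
    (hSSC : PullBackSSC G K x₀ J₁ J₂) : QuadraticGrowth (G ⁻¹' K) J x₀ := by
  by_contra hgrowth
  obtain ⟨t, u, h, b, ht, hu1, hu, hmem, hb, hle⟩ := exists_seq_of_not_quadraticGrowth hJ hgrowth
  set A := fderiv ℝ G x₀ with hA
  have hh0 : h ≠ 0 := by
    rintro rfl
    obtain ⟨δ, hδ, hlt⟩ := EReal.lt_iff_exists_real_btwn.1 (hNDC u t ht hu hmem hu1)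
    have hδ : (0 : ℝ) < δ := by exact_mod_cast hδ
    obtain ⟨k, hk1, hk2⟩ := ((eventually_lt_of_lt_liminf hlt).and (hb.eventually_lt_const hδ)).exists
    have hk1 := EReal.coe_lt_coe_iff.1 hk1
    linarith [hle k]
  have hJu := hu.tendsto_apply hJ.1
  have hJh : J₁ h = 0 := by
    refine le_antisymm ?_ ?_
    -- The violated growth inequality, multiplied by `t k`, gives `J₁ h ≤ 0`; the normal cone
    -- condition gives the reverse.
    · have hl : Tendsto (fun k => t k * (b k + 1 / 2 * ‖J₂‖)) atTop (𝓝 0) := by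
        simpa using ht.2.mul (hb.add_const (1 / 2 * ‖J₂‖))
      refine le_of_tendsto_of_tendsto' hJu hl fun k => ?_
      have h2 : |J₂ (u k) (u k)| ≤ ‖J₂‖ := by
        simpa [hu1 k] using J₂.le_opNorm₂ (u k) (u k)
      have h3 : J₁ (u k) / t k ≤ b k + 1 / 2 * ‖J₂‖ := by
        linarith [hle k, neg_abs_le (J₂ (u k) (u k))]
      rw [div_le_iff₀ (ht.1 k)] at h3
      linarith
    · have := (mem_neg.1 hJ₁).2 h ⟨t, fun k => x₀ + t k • u k, ht, hmem, by
        convert hu using 2 with k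
        rw [add_sub_cancel_left, smul_smul, inv_mul_cancel₀ (ht.1 k).ne', one_smul]⟩
      simpa using this
  have hAu : Tendsto (fun k => A (u k)) atTop (𝓝 (A h)) := hG₁ u h hu
  have hQu : Tendsto (fun k => secondDerivSq G x₀ (u k)) atTop (𝓝 (secondDerivSq G x₀ h)) :=
    hG₂ u h hu
  obtain ⟨p, hpt, hexp⟩ : ∃ p : ℕ → Z, Tendsto p atTop (𝓝 (secondDerivSq G x₀ h)) ∧
      ∀ k, G (x₀ + t k • u k) = G x₀ + t k • A (u k) + (1 / 2 * t k ^ 2 : ℝ) • p k := by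
    refine ⟨_, by simpa only [smul_zero, add_zero] using hQu.add ((tendsto_taylor_remainder hG x₀ ht
      fun k => (hu1 k).le).const_smul (2 : ℝ)), fun k => ?_⟩
    rw [smul_add, smul_smul, smul_smul, show 1 / 2 * t k ^ 2 * 2 * (t k ^ 2)⁻¹ = 1 by
      field_simp [(ht.1 k).ne'], one_smul]
    abel
  have htan : A h ∈ tangentCone K (G x₀) := by
    refine ⟨t, fun k => G (x₀ + t k • u k), ht, hmem, ?_⟩
    have := hAu.add ((ht.2.const_mul (1 / 2)).smul hpt)
    rw [mul_zero, zero_smul, add_zero] at this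
    refine this.congr fun k => ?_
    have htk := (ht.1 k).ne'
    dsimp only
    rw [hexp, add_assoc, add_sub_cancel_left, smul_add, smul_smul, smul_smul,
      inv_mul_cancel₀ htk, one_smul, show (t k)⁻¹ * (1 / 2 * t k ^ 2) = 1 / 2 * t k by field_simp]
  obtain ⟨m, hm, hmle⟩ := EReal.lt_iff_exists_real_btwn.1
    ((zero_lt_coe_add_iff _ _).1 (hSSC h ⟨⟨hJh, htan⟩, hh0⟩))
  have hm : -J₂ h h < m := EReal.coe_lt_coe_iff.1 hm
  have hmr : ∀ r, A r + secondDerivSq G x₀ h ∈ secondTangentSet K (G x₀) (A h) → m ≤ J₁ r :=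
    fun r hr => EReal.coe_le_coe_iff.1
      (hmle.le.trans (iInf₂_le r (mem_preimage_sub_singleton_iff.2 hr)))
  obtain ⟨e, he, hmemT⟩ := hreg.exists_correction htan (t := t)
    (r := fun k => (2 * (t k)⁻¹) • (A (u k) - A h) + p k) ht (by
      have := ((hAu.sub_const (A h)).const_smul (2 : ℝ)).add (ht.2.smul hpt)
      rw [sub_self, smul_zero, zero_smul, add_zero] at this
      refine this.congr fun k => ?_
      rw [smul_add, smul_smul, show t k * (2 * (t k)⁻¹) = 2 by field_simp [(ht.1 k).ne']])
    (fun k => by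
      have hk := hmem k
      rw [mem_preimage, hexp] at hk
      convert hk using 1
      rw [smul_add (1 / 2 * t k ^ 2 : ℝ), smul_smul, show 1 / 2 * t k ^ 2 * (2 * (t k)⁻¹) = t k by
        field_simp [(ht.1 k).ne']]
      module)
  obtain ⟨M, hM, hdec⟩ := exists_bounded_decomposition A hKc hK hx₀ hCQ
  choose v w hw hvw hvn using fun k => hdec (p k - secondDerivSq G x₀ h + e k)
  have hv : Tendsto v atTop (𝓝 0) := by
    have h0 : Tendsto (fun k => p k - secondDerivSq G x₀ h + e k) atTop (𝓝 0) := by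
      simpa using (hpt.sub_const (secondDerivSq G x₀ h)).add he
    refine squeeze_zero_norm hvn ?_
    simpa using (tendsto_zero_iff_norm_tendsto_zero.1 h0).const_mul M
  have hJv : Tendsto (fun k => J₁ (v k)) atTop (𝓝 0) := by
    exact map_zero J₁ ▸ (J₁.continuous.tendsto 0).comp hv
  have hup : ∀ᶠ k in atTop, J₂ (u k) (u k) ≤ 2 * b k + J₁ (v k) - m := by
    filter_upwards [hmemT] with k hk
    -- Its image under `A` plus `G''(x₀) h²` is the corrected second-order tangent plus the radial
    -- direction `w k`.
    have hfeas := hmr ((2 * (t k)⁻¹) • (u k - h) + v k) (by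
      convert add_mem_secondTangentSet hK ⟨_, hx₀⟩ hk (hw k) using 1
      rw [map_add, map_smul, map_sub, ← sub_eq_zero]
      have := sub_eq_zero.2 (hvw k)
      rw [← neg_eq_zero, ← this]
      abel)
    rw [map_add, map_smul, map_sub, hJh, sub_zero, smul_eq_mul] at hfeas
    have := hle k
    rw [div_eq_mul_inv] at this
    linarith
  obtain ⟨δ, hδ1, hδ2⟩ := exists_between (show -m < J₂ h h by linarith)
  have hlsc := eventually_lt_of_lt_liminf
    ((EReal.coe_lt_coe_iff.2 hδ2).trans_le (hJ₂ u h hu))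
  have hlim : Tendsto (fun k => 2 * b k + J₁ (v k) - m) atTop (𝓝 (-m)) := by
    simpa using ((hb.const_mul 2).add hJv).sub_const m
  obtain ⟨k, h1, h2, h3⟩ := (hup.and (hlsc.and (hlim.eventually_lt_const hδ1))).exists
  have h2 := EReal.coe_lt_coe_iff.1 h2
  linarith

/-- Under the multiplier conditions, the infimum over the pulled-back second-order tangent set is
the curvature of `K` plus the curvature contribution of `G`. -/
theorem iInf_pullBack_eq_curvature {W : Type*} [NormedAddCommGroup W] [NormedSpace ℝ W]
    (e : Z ≃ₗᵢ[ℝ] StrongDual ℝ W) {G : X → Z} {K : Set Z} (hK : Convex ℝ K) (hne : K.Nonempty)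
    {x₀ : X} {J₁ : StrongDual ℝ X} (hreg : SecondOrderRegular K (G x₀)) {lam : StrongDual ℝ Z}
    (hlam : J₁ + lam.comp (fderiv ℝ G x₀) = 0) (hMRC : MoscoRegular e K (G x₀) (-lam))
    (hCQ : range (fderiv ℝ G x₀) - (radialCone K (G x₀) ∩ {z | lam z = 0}) = univ) {h : X}
    (hJh : J₁ h = 0) (hh : fderiv ℝ G x₀ h ∈ tangentCone K (G x₀)) :
    (⨅ r ∈ fderiv ℝ G x₀ ⁻¹'
        (secondTangentSet K (G x₀) (fderiv ℝ G x₀ h) - {secondDerivSq G x₀ h}),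
        ((J₁ r : ℝ) : EReal)) =
      ((lam (secondDerivSq G x₀ h) : ℝ) : EReal) +
        curvature e K (G x₀) (-lam) (fderiv ℝ G x₀ h) := by
  set A := fderiv ℝ G x₀ with hA
  have hJA : ∀ r, J₁ r = -lam (A r) := fun r => by
    have := DFunLike.congr_fun hlam r
    simp only [add_apply, ContinuousLinearMap.comp_apply, zero_apply] at this
    linarith
  refine le_antisymm ?_ (le_iInf₂ fun r hr => ?_)
  · obtain ⟨r, t, ht, htr, hmem, hlim⟩ := hMRC (A h)
      ⟨tangentCone_subset_weakStarTangentCone e K _ hh, by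
        rw [neg_apply, ← hJA, hJh]⟩
    obtain ⟨ε, hε, hT⟩ := hreg.exists_correction hh ht htr hmem
    have hlε : Tendsto (fun k => ((lam (secondDerivSq G x₀ h) - lam (ε k) : ℝ) : EReal)) atTop
        (𝓝 ((lam (secondDerivSq G x₀ h) : ℝ) : EReal)) := by
      refine (continuous_coe_real_ereal.tendsto _).comp ?_
      simpa using ((lam.continuous.tendsto 0).comp hε).const_sub (lam (secondDerivSq G x₀ h))
    -- The curvature may be infinite; addition is continuous here because the other summand is
    -- finite.
    have hsum := (EReal.continuousAt_add (p := (((lam (secondDerivSq G x₀ h) : ℝ) : EReal),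
      curvature e K (G x₀) (-lam) (A h))) (Or.inl (EReal.coe_ne_top _))
      (Or.inl (EReal.coe_ne_bot _))).tendsto.comp (hlε.prodMk_nhds hlim)
    refine ge_of_tendsto hsum ?_
    filter_upwards [hT] with k hk
    -- The radial correction `w` is annihilated by `lam`, so the lifted `r'` has exactly the
    -- required value.
    obtain ⟨_, ⟨r', rfl⟩, w, ⟨hw, hw0⟩, heq⟩ := hCQ.symm ▸ mem_univ
      (r k + ε k - secondDerivSq G x₀ h)
    have heq : A r' - w = r k + ε k - secondDerivSq G x₀ h := heq
    have hw0 : lam w = 0 := hw0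
    have hr' : r' ∈ A ⁻¹' (secondTangentSet K (G x₀) (A h) - {secondDerivSq G x₀ h}) := by
      rw [mem_preimage_sub_singleton_iff]
      convert add_mem_secondTangentSet hK hne hk hw using 1
      rw [sub_eq_sub_iff_add_eq_add] at heq
      exact heq
    refine (iInf₂_le r' hr').trans (le_of_eq ?_)
    rw [Function.comp_apply, ← EReal.coe_add]
    congr 1
    have := congrArg lam heq
    simp only [map_sub, map_add, hw0, sub_zero] at this
    rw [hJA, this, neg_apply]
    ring
  · rw [mem_preimage_sub_singleton_iff] at hr
    obtain ⟨t, q, ht, hq, hmem⟩ := exists_seq_of_mem_secondTangentSet hne hr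
    have hc : curvature e K (G x₀) (-lam) (A h) ≤
        ((J₁ r - lam (secondDerivSq G x₀ h) : ℝ) : EReal) := by
      refine sInf_le ⟨q, t, ht, weakStarTendsto_of_tendsto e (by simpa using ht.2.smul hq), hmem,
        (Tendsto.liminf_eq ?_).symm⟩
      refine (continuous_coe_real_ereal.tendsto _).comp ?_
      have hval : J₁ r - lam (secondDerivSq G x₀ h) = (-lam) (A r + secondDerivSq G x₀ h) := by
        rw [hJA, neg_apply, map_add]
        ring
      exact hval ▸ ((-lam).continuous.tendsto _).comp hq
    calc _ ≤ ((lam (secondDerivSq G x₀ h) : ℝ) : EReal) +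
          ((J₁ r - lam (secondDerivSq G x₀ h) : ℝ) : EReal) := by gcongr
      _ = _ := by rw [← EReal.coe_add, add_sub_cancel]

end Conditions

end NoGap

theorem mainTheorem8
    {X Y Z : Type*}
    [NormedAddCommGroup Y] [NormedSpace ℝ Y] [CompleteSpace Y] [TopologicalSpace.SeparableSpace Y]
    [NormedAddCommGroup X] [NormedSpace ℝ X]
    [NormedAddCommGroup Z] [NormedSpace ℝ Z] [CompleteSpace Z]
    (d : X ≃ₗᵢ[ℝ] StrongDual ℝ Y)
    (G : X → Z) (hG : ContDiff ℝ 2 G)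
    (K : Set Z) (hK_closed : IsClosed K) (hK_convex : Convex ℝ K) (hK_nonempty : K.Nonempty)
    (C : Set X) (hC : C = G ⁻¹' K)
    (x₀ : X) (hx₀ : x₀ ∈ C)
    (J : X → ℝ) (J₁ : StrongDual ℝ X) (J₂ : X →L[ℝ] X →L[ℝ] ℝ)
    (hJ : NoGap.HasWeakStarTaylor d C J x₀ J₁ J₂)
    (hJ₁ : J₁ ∈ -NoGap.weakStarNormalCone d C x₀)
    (hJ₂ : NoGap.WeakStarLSC d (fun h => J₂ h h))
    (hNDC : NoGap.NonDegenerate d C x₀ J₁ J₂)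
    (hG₁ : NoGap.WeakStarToStrongContinuous d (fun h => fderiv ℝ G x₀ h))
    (hG₂ : NoGap.WeakStarToStrongContinuous d (fun h => NoGap.secondDerivSq G x₀ h))
    (hK_reg : NoGap.SecondOrderRegular K (G x₀))
    (hCQ : range (fderiv ℝ G x₀) - NoGap.radialCone K (G x₀) = univ) :
    (NoGap.PullBackSSC G K x₀ J₁ J₂ ↔ NoGap.QuadraticGrowth C J x₀) ∧
    (∀ {W : Type*} [NormedAddCommGroup W] [NormedSpace ℝ W] [CompleteSpace W]
        [TopologicalSpace.SeparableSpace W]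
        (e : Z ≃ₗᵢ[ℝ] StrongDual ℝ W)
        (lam : StrongDual ℝ Z),
      lam ∈ NoGap.weakStarNormalCone e K (G x₀) →
      J₁ + lam.comp (fderiv ℝ G x₀) = 0 →
      NoGap.MoscoRegular e K (G x₀) (-lam) →
      range (fderiv ℝ G x₀) - (NoGap.radialCone K (G x₀) ∩ {z | lam z = 0}) = univ →
      (NoGap.PullBackSSC G K x₀ J₁ J₂ ↔
        ∀ h ∈ NoGap.nonzeroCriticalDirections G K x₀ J₁,
          (0 : EReal) < ((NoGap.lagrangianHessianSq G x₀ J₂ lam h : ℝ) : EReal) +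
            NoGap.curvature e K (G x₀) (-lam) (fderiv ℝ G x₀ h))) := by

  subst hC
  have : CompleteSpace X := d.toIsometryEquiv.completeSpace
  refine ⟨⟨fun h => h.quadraticGrowth hG hK_closed hK_convex hx₀ hJ hJ₁ hJ₂ hNDC hG₁ hG₂ hK_reg
    hCQ, fun h => h.pullBackSSC hG hK_closed hK_convex hK_nonempty hJ hCQ⟩, ?_⟩
  intro W _ _ _ _ e lam _ hlam hMRC hCQ'
  refine forall₂_congr fun h hh => ?_
  rw [NoGap.iInf_pullBack_eq_curvature e hK_convex hK_nonempty hK_reg hlam hMRC hCQ' hh.1.1 hh.1.2,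
    ← add_assoc, NoGap.lagrangianHessianSq, EReal.coe_add]
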